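/- **Setting.** Consider either the nonlinear least-squares problem (NLS) $\min_{x\in\mathbb R^n} f(x)=\frac1{2m}\|R(x)\|^2$ with $R:\mathbb R^n\to\mathbb R^m$ continuously differentiable, $m\ge 1$, or a square nonlinear system (NSE) $R(x)=0$ with $R:\mathbb R^n\to\mathbb R^n$ continuously differentiable and $f(x)=\frac12\|R(x)\|^2$. Put $\rho=1/m$ for NLS and $\rho=1$ for NSE, and let $J$ be the Jacobian of $R$; $\|\cdot\|$ is the Euclidean norm of vectors and the spectral norm of matrices. Assume that $f$ has a global minimizer, with minimum $f^*$ (for NSE: that $R$ has a zero, so $f^*=0$), and that $\nabla f$ is Lipschitz continuous on $\mathbb R^n$ with constant $L\ge0$. **Algorithm.** Let $c,\tau,\bar\eta\in(0,1)$, $0<t_0\le t_{\max}$, $x_0\in\mathbb R^n$. On a probability space, put $X_0=x_0$, $T_0=t_0$. Iteration $k\ge0$ forms a random matrix $\widetilde J_k$, a vector $\widetilde R_k$ and the gradient estimate $g_k=\rho\widetilde J_k^T\widetilde R_k$, by one of two variants. * *Row compression* (NLS only): for a random nonempty index set $\mathcal M_k\subset\{1,\dots,m\}$ and random weights, $\widetilde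 J_k$ consists of the rows of $J(X_k)$ with index in $\mathcal M_k$, each multiplied by its weight, and $\widetilde R_k$ of the entries of $R(X_k)$ with index in $\mathcal M_k$. * *Jacobian sampling* (NLS or NSE): $\widetilde J_k$ is a random matrix of the size of $J$, and $\widetilde R_k=R(X_k)$. Then a step $s_k$ is computed that minimizes $\|\widetilde J_ks+\widetilde R_k\|$ over a linear subspace $K_k$ of $\mathbb R^n$ and satisfies $\|\widetilde J_k^T(\widetilde J_ks_k+\widetilde R_k)\|\le\eta_k\|\widetilde J_k^T\widetilde R_k\|$ for some $\eta_k\in[0,\bar\eta)$. For row compression, $K_k$ is a Krylov space $\mathrm{span}\{(\widetilde J_k^T\widetilde J_k)^i\widetilde J_k^T\widetilde R_k: 0\le i<\ell\}$; for Jacobian sampling it may be any subspace. If $f(X_k+T_ks_k)\le f(X_k)+cT_ks_k^Tg_k$, then $X_{k+1}=X_k+T_ks_k$ and $T_{k+1}=\min\{t_{\max},\tau^{-1}T_k\}$ (successful iteration); otherwise $X_{k+1}=X_k$ and $T_{k+1}=\tau T_k$. Let $(\mathcal F_{k-1})_{k\ge0}$ be a filtration such that everything generated in iterations $0,\dots,k-1$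 is $\mathcal F_{k-1}$-measurable. **True iterations.** Let $\alpha>0$ and $0<\sigma_{\min}\le\sigma_{\max}$. Iteration $k$ is *true* if all nonzero eigenvalues of $\widetilde J_k^T\widetilde J_k$ lie in $[\sigma_{\min},\sigma_{\max}]$ and, moreover, $\|\nabla f(X_k)-g_k\|\le\alpha T_k\|g_k\|$ (row compression), respectively $\|J(X_k)-\widetilde J_k\|\le\alpha T_k$ (Jacobian sampling). Assume that for some $\delta\in(0,\frac12)$ and all $k$, almost surely, $\mathbb P(\text{iteration }k\text{ is true}\mid\mathcal F_{k-1})\ge1-\delta$. **Hitting time.** Let $\epsilon>0$, and let $N_\epsilon\in\{0,1,\dots,\infty\}$ be the first $k$ with $\|\nabla f(X_k)\|\le\epsilon$. Assume that for some $\mu>0$, almost surely, at all true iterations $k<N_\epsilon$, $\|\widetilde V_k^Ts_k\|\ge\mu\|s_k\|$, where $\widetilde J_k=\widetilde U_k\widetilde\Sigma_k\widetilde V_k^T$ is a rank retaining singular value decomposition. For Jacobian sampling assume also that for some $\kappa_3>0$, almost surely, at all these iterations $\|\widetilde J_k^TR(X_k)\|\ge\frac1{\kappa_3}\|R(X_k)\|$.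 **Constants.** Let $$\kappa_1=\frac1{\rho\,\sigma_{\min}\mu^2},\qquad \kappa_2=\frac{1-\bar\eta}{\rho\,\sigma_{\max}},\qquad \theta=\frac{2(1-c)\kappa_2}{(\kappa_2L+2\beta)\kappa_1},$$ with $\beta=\alpha$ for row compression and $\beta=\alpha\kappa_3$ for Jacobian sampling. Let $0<\bar t<t_0$ be such that either $\bar t\le\theta$ and both $\bar t$ and $t_{\max}$ are of the form $t_0\tau^i$ with $i\in\mathbb Z$, or $\bar t\le\tau\theta$. **Theorem.** Under these assumptions, $$\mathbb E[N_\epsilon]\le\frac{2(1-\delta)}{(1-2\delta)^2}\left[\frac M{\epsilon^2}+\log_\tau\frac{\bar t}{t_0}\right],\qquad M=\frac{(f(x_0)-f^*)(1+\beta t_{\max})^2\kappa_1}{c\,\kappa_2^2\,\bar t}.$$ -/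

import Mathlib

open MeasureTheory ProbabilityTheory
open scoped ENNReal

namespace StochasticGaussNewton

/-! Matrices in `ℝ^{p × n}` are represented by continuous linear maps between Euclidean spaces; the
transpose is then the adjoint and the operator norm is the spectral norm. -/

/-- The Euclidean space `ℝⁿ` with the `2`-norm. -/
abbrev Euc (n : ℕ) : Type := EuclideanSpace ℝ (Fin n)

section LeastSquares

variable {n : ℕ} {F : Type*} [NormedAddCommGroup F] [InnerProductSpace ℝ F] [CompleteSpace F]

/-- The scaled least-squares objective `x ↦ (ρ/2) ‖R(x)‖²`: `ρ = 1/m` is the nonlinear least-squares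
objective `(1/(2m)) ‖R(x)‖²`, and `ρ = 1` is the objective `(1/2) ‖F(x)‖²` of a nonlinear system. -/
noncomputable def objective (ρ : ℝ) (R : Euc n → F) (x : Euc n) : ℝ :=
  ρ / 2 * ‖R x‖ ^ 2

/-- The linearised model `s ↦ (ρ/2) ‖A s + b‖²`. -/
noncomputable def model (ρ : ℝ) (A : Euc n →L[ℝ] F) (b : F) (s : Euc n) : ℝ :=
  ρ / 2 * ‖A s + b‖ ^ 2

/-- The gradient estimate `ρ Aᵀ b` which goes with the model `s ↦ (ρ/2) ‖A s + b‖²`. -/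
noncomputable def gradEstimate (ρ : ℝ) (A : Euc n →L[ℝ] F) (b : F) : Euc n :=
  ρ • (ContinuousLinearMap.adjoint A) b

/-- The Krylov space `span {Aᵀ b, (AᵀA) Aᵀ b, …, (AᵀA)^(ℓ-1) Aᵀ b}`. -/
noncomputable def krylov (A : Euc n →L[ℝ] F) (b : F) (ℓ : ℕ) : Submodule ℝ (Euc n) :=
  Submodule.span ℝ (Set.range fun i : Fin ℓ =>
    (((ContinuousLinearMap.adjoint A).comp A) ^ (i : ℕ)) ((ContinuousLinearMap.adjoint A) b))

/-- `s` is an inexact Gauss-Newton step computed in the subspace `K`: it minimises the model over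
`K`, and its residual `r = A s + b` passes the stopping test `‖Aᵀ r‖ ≤ η ‖Aᵀ b‖`. -/
def IsInexactStep (ρ : ℝ) (A : Euc n →L[ℝ] F) (b : F) (η : ℝ) (K : Submodule ℝ (Euc n))
    (s : Euc n) : Prop :=
  s ∈ K ∧ (∀ v ∈ K, model ρ A b s ≤ model ρ A b v) ∧
    ‖(ContinuousLinearMap.adjoint A) (A s + b)‖ ≤ η * ‖(ContinuousLinearMap.adjoint A) b‖

/-- The spectral event: the first `rank A` singular values of `AᵀA`, that is, all the nonzero
eigenvalues of `AᵀA`, lie in `[σmin, σmax]`. -/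
def SpectralEvent (σmin σmax : ℝ) (A : Euc n →L[ℝ] F) : Prop :=
  ∀ ev ∈ spectrum ℝ ((ContinuousLinearMap.adjoint A).comp A),
    ev ≠ 0 → σmin ≤ ev ∧ ev ≤ σmax

/-- `‖Vᵀ s‖`, where `A = U Σ Vᵀ` is a rank retaining singular value decomposition. The columns of
`V` are an orthonormal basis of the row space of `A` (the range of `Aᵀ`), so this number is the norm
of the orthogonal projection of `s` on the row space. -/
noncomputable def rowSpaceNorm (A : Euc n →L[ℝ] F) (s : Euc n) : ℝ :=
  ‖(LinearMap.range (ContinuousLinearMap.adjoint A).toLinearMap).starProjection s‖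

end LeastSquares

section Compression

variable {n m : ℕ}

/-- Selection of the components with index in `M`, the `i`-th one being multiplied by `w i`:
the linear map `ℝᵐ → ℝ^M`, `v ↦ (w i * v i)_{i ∈ M}`. -/
noncomputable def selectRows (M : Finset (Fin m)) (w : Fin m → ℝ) :
    Euc m →L[ℝ] EuclideanSpace ℝ M :=
  LinearMap.toContinuousLinearMap
    { toFun := fun v => WithLp.toLp 2 fun i : M => w i * v i
      map_add' := fun u v => by ext i; simp [mul_add]
      map_smul' := fun a v => by ext i; simp [mul_left_comm] }

/-- The compressed Jacobian at `x`: the rows of `J(x)` with index in `M`, weighted by `w`. -/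
noncomputable def compressedJac (R : Euc n → Euc m) (x : Euc n) (M : Finset (Fin m))
    (w : Fin m → ℝ) : Euc n →L[ℝ] EuclideanSpace ℝ M :=
  (selectRows M w).comp (fderiv ℝ R x)

/-- The compressed residual at `x`: the (unweighted) components of `R(x)` with index in `M`. -/
noncomputable def compressedRes (R : Euc n → Euc m) (x : Euc n) (M : Finset (Fin m)) :
    EuclideanSpace ℝ M :=
  selectRows M (fun _ => 1) (R x)

end Compression

section Runs

variable {n m : ℕ} {Ω : Type*}

/-- The line-search scheme, for every realization `ω`: `X k`, `T k`, `S k`, `G k` are the iterate,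
the step-length, the search direction and the gradient estimate of iteration `k`. -/
structure IsLineSearchRun (f : Euc n → ℝ) (c τ tmax t₀ : ℝ) (x₀ : Euc n)
    (X : ℕ → Ω → Euc n) (T : ℕ → Ω → ℝ) (S G : ℕ → Ω → Euc n) : Prop where
  X_zero : ∀ ω, X 0 ω = x₀
  T_zero : ∀ ω, T 0 ω = t₀
  successful : ∀ k ω,
    f (X k ω + T k ω • S k ω) ≤ f (X k ω) + c * T k ω * inner ℝ (S k ω) (G k ω) →
      X (k + 1) ω = X k ω + T k ω • S k ω ∧ T (k + 1) ω = min tmax (τ⁻¹ * T k ω)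
  unsuccessful : ∀ k ω,
    ¬ f (X k ω + T k ω • S k ω) ≤ f (X k ω) + c * T k ω * inner ℝ (S k ω) (G k ω) →
      X (k + 1) ω = X k ω ∧ T (k + 1) ω = τ * T k ω

/-- The hitting time: the first `k` with `‖∇f(X_k)‖ ≤ ε`, and `⊤` if there is none. -/
noncomputable def hittingTime (f : Euc n → ℝ) (X : ℕ → Ω → Euc n) (ε : ℝ) (ω : Ω) : ℕ∞ :=
  ⨅ k : {k : ℕ // ‖gradient f (X k ω)‖ ≤ ε}, ((k : ℕ) : ℕ∞)

variable [mΩ : MeasurableSpace Ω]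

/-- A run of the line-search inexact Gauss-Newton method with row compression of the Jacobian, for
the problem `min (1/(2m)) ‖R(x)‖²`. At iteration `k` the rows with index in the nonempty random set
`M k` are selected, with random weights `w k`, and the step is computed in a Krylov space. The
σ-algebra `ℱ k` is the information available at the beginning of iteration `k`, so the quantities
generated at iteration `k` are `ℱ (k + 1)`-measurable. -/
structure IsRowCompressionRun (ℱ : Filtration ℕ mΩ) (R : Euc n → Euc m)
    (c τ tmax t₀ ηbar : ℝ) (x₀ : Euc n)
    (X : ℕ → Ω → Euc n) (T : ℕ → Ω → ℝ) (S : ℕ → Ω → Euc n)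
    (M : ℕ → Ω → Finset (Fin m)) (w : ℕ → Ω → Fin m → ℝ) : Prop where
  lineSearch : IsLineSearchRun (objective (1 / m) R) c τ tmax t₀ x₀ X T S
    fun k ω => gradEstimate (1 / m) (compressedJac R (X k ω) (M k ω) (w k ω))
      (compressedRes R (X k ω) (M k ω))
  nonempty : ∀ k ω, (M k ω).Nonempty
  step : ∀ k ω, ∃ η : ℝ, 0 ≤ η ∧ η < ηbar ∧ ∃ ℓ : ℕ,
    IsInexactStep (1 / m) (compressedJac R (X k ω) (M k ω) (w k ω))
      (compressedRes R (X k ω) (M k ω)) η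
      (krylov (compressedJac R (X k ω) (M k ω) (w k ω)) (compressedRes R (X k ω) (M k ω)) ℓ)
      (S k ω)
  measurable_M : ∀ k A, MeasurableSet[ℱ (k + 1)] {ω | M k ω = A}
  measurable_w : ∀ k, Measurable[ℱ (k + 1)] (w k)
  measurable_S : ∀ k, Measurable[ℱ (k + 1)] (S k)

/-- A run of the line-search inexact Gauss-Newton method with Jacobian sampling, for the objective
`(ρ/2) ‖R(x)‖²`: `Jt k` is the random Jacobian of iteration `k`, and the step minimises the model
over some subspace of `ℝⁿ` (any Krylov space, for instance). The σ-algebra `ℱ k` is the information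
available at the beginning of iteration `k`. -/
structure IsJacobianSamplingRun (ℱ : Filtration ℕ mΩ) (ρ : ℝ) (R : Euc n → Euc m)
    (c τ tmax t₀ ηbar : ℝ) (x₀ : Euc n)
    (X : ℕ → Ω → Euc n) (T : ℕ → Ω → ℝ) (S : ℕ → Ω → Euc n)
    (Jt : ℕ → Ω → Euc n →L[ℝ] Euc m) : Prop where
  lineSearch : IsLineSearchRun (objective ρ R) c τ tmax t₀ x₀ X T S
    fun k ω => gradEstimate ρ (Jt k ω) (R (X k ω))
  step : ∀ k ω, ∃ η : ℝ, 0 ≤ η ∧ η < ηbar ∧ ∃ K : Submodule ℝ (Euc n),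
    IsInexactStep ρ (Jt k ω) (R (X k ω)) η K (S k ω)
  measurable_Jt : ∀ k, Measurable[ℱ (k + 1)] (Jt k)
  measurable_S : ∀ k, Measurable[ℱ (k + 1)] (S k)

/-- Iteration `k` of the row-compression method is true: the spectral event holds and the gradient
estimate is sufficiently accurate, `‖∇f(X_k) - G_k‖ ≤ α t_k ‖G_k‖`. -/
def TrueRC (R : Euc n → Euc m) (σmin σmax α : ℝ) (X : ℕ → Ω → Euc n) (T : ℕ → Ω → ℝ)
    (M : ℕ → Ω → Finset (Fin m)) (w : ℕ → Ω → Fin m → ℝ) (k : ℕ) (ω : Ω) : Prop :=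
  SpectralEvent σmin σmax (compressedJac R (X k ω) (M k ω) (w k ω)) ∧
    ‖gradient (objective (1 / m) R) (X k ω) -
        gradEstimate (1 / m) (compressedJac R (X k ω) (M k ω) (w k ω))
          (compressedRes R (X k ω) (M k ω))‖ ≤
      α * T k ω * ‖gradEstimate (1 / m) (compressedJac R (X k ω) (M k ω) (w k ω))
          (compressedRes R (X k ω) (M k ω))‖

/-- Iteration `k` of the Jacobian-sampling method is true: the spectral event holds and the random
Jacobian is sufficiently accurate, `‖J(X_k) - Jt_k‖ ≤ α t_k`. -/
def TrueJS (R : Euc n → Euc m) (σmin σmax α : ℝ) (X : ℕ → Ω → Euc n) (T : ℕ → Ω → ℝ)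
    (Jt : ℕ → Ω → Euc n →L[ℝ] Euc m) (k : ℕ) (ω : Ω) : Prop :=
  SpectralEvent σmin σmax (Jt k ω) ∧ ‖fderiv ℝ R (X k ω) - Jt k ω‖ ≤ α * T k ω

end Runs

section Constants

/-- `κ₁ = 1 / (ρ σmin μ²)`. -/
noncomputable def kappa₁ (ρ σmin μ : ℝ) : ℝ := 1 / (ρ * σmin * μ ^ 2)

/-- `κ₂ = (1 - ηbar) / (ρ σmax)`. -/
noncomputable def kappa₂ (ρ σmax ηbar : ℝ) : ℝ := (1 - ηbar) / (ρ * σmax)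

/-- `2 (1 - c) κ₂ / ((κ₂ L + 2 β) κ₁)`: at true iterations, step-lengths up to this threshold are
accepted by the line search. -/
noncomputable def stepThreshold (c κ₁ κ₂ β L : ℝ) : ℝ :=
  2 * (1 - c) * κ₂ / ((κ₂ * L + 2 * β) * κ₁)

/-- Admissible values of `tbar < t₀`: either `tbar` is at most the threshold `θ` and both `tbar` and
`tmax` belong to the grid `{t₀ τ^i : i ∈ ℤ}`, or `tbar ≤ τ θ`. -/
def IsAdmissible (τ tmax t₀ θ tbar : ℝ) : Prop :=
  0 < tbar ∧ tbar < t₀ ∧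
    ((tbar ≤ θ ∧ (∃ j : ℕ, tbar = t₀ * τ ^ j) ∧ (∃ i : ℕ, t₀ = tmax * τ ^ i)) ∨ tbar ≤ τ * θ)

/-- `(2 (1 - δ) / (1 - 2 δ)²) (M / ε² + log_τ (tbar / t₀))` with
`M = (f(x₀) - f*) (1 + β tmax)² κ₁ / (c κ₂² tbar)`; here `gap = f(x₀) - f*`. -/
noncomputable def complexityBound (gap c τ tmax t₀ κ₁ κ₂ β δ ε tbar : ℝ) : ℝ :=
  2 * (1 - δ) / (1 - 2 * δ) ^ 2 *
    (gap * (1 + β * tmax) ^ 2 * κ₁ / (c * κ₂ ^ 2 * tbar) / ε ^ 2 + Real.logb τ (tbar / t₀))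

end Constants

end StochasticGaussNewton

open StochasticGaussNewton

/-! The proof is a drift argument for one potential. Measure the step-length by the integer
`stepLevel`, its rounded logarithmic position relative to `tbar`, and set `W k = |level of T k| + 2
(f (X k) - f*) / h`, where `h` is the decrease of `f` guaranteed by an accepted true step with `T k
≥ tbar`. Before the hitting time each iteration raises `W` by at most one, and each true iteration
lowers it by at least one.

The first claim holds because the level moves by at most one and `f` never increases: minimality of
`s` over a subspace gives `sᵀg = -ρ ‖A s‖² ≤ 0`, on true and false iterations alike. For the second,
let the iteration be true. If the level is negative and the step succeeds, or the level is positive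
and the step fails, then the level moves towards zero. If the level is nonnegative and the step
succeeds, the objective term falls by at least two and the level term rises by at most one
(`decrease_of_accepted`). The remaining case, failure at a nonpositive level, cannot occur: there `T
k ≤ θ` (`stepLength_le_threshold`), and such steps are accepted (`line_search_accepts`).

True iterations have conditional probability at least `1 - δ > 1/2`, so `lintegral_le_of_drift`
bounds the expected hitting time by `W 0 / (1 - 2δ)`, which is at most the stated bound. The methods
enter only through three estimates at true iterations: `‖s‖² ≤ κ₁ (-sᵀg)`, `κ₂ ‖g‖ ≤ ‖s‖` and `‖∇f -
g‖ ≤ β t ‖g‖`. -/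

namespace StochasticGaussNewton

/-! ### Inexact Gauss-Newton steps and the spectral event. -/

section Step

variable {n : ℕ} {F : Type*} [NormedAddCommGroup F] [InnerProductSpace ℝ F] [CompleteSpace F]

theorem inner_gradEstimate (ρ : ℝ) (A : Euc n →L[ℝ] F) (b : F) (s : Euc n) :
    inner ℝ s (gradEstimate ρ A b) = ρ * inner ℝ (A s) b := by
  simp [gradEstimate, inner_smul_right, ContinuousLinearMap.adjoint_inner_right]

/-- Only competitors on the line through `s` are needed, so any subspace will do, Krylov or not. -/
theorem IsInexactStep.inner_residual {ρ η : ℝ} (hρ : 0 < ρ) {A : Euc n →L[ℝ] F} {b : F}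
    {K : Submodule ℝ (Euc n)} {s : Euc n} (h : IsInexactStep ρ A b η K s) :
    inner ℝ (A s) (A s + b) = 0 := by
  obtain ⟨hs, hmin, -⟩ := h
  have key : ∀ t : ℝ, 0 ≤ 2 * t * inner ℝ (A s) (A s + b) + t ^ 2 * ‖A s‖ ^ 2 := by
    intro t
    have h1 := hmin (s + t • s) (K.add_mem hs (K.smul_mem t hs))
    have h2 : A (s + t • s) + b = (A s + b) + t • A s := by
      simp only [map_add, map_smul]; abel
    rw [model, model, h2, norm_add_sq_real (A s + b), inner_smul_right, norm_smul, mul_pow,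
      Real.norm_eq_abs, sq_abs, real_inner_comm] at h1
    have h3 := le_of_mul_le_mul_left h1 (by positivity : 0 < ρ / 2)
    linarith
  set a : ℝ := inner ℝ (A s) (A s + b)
  rcases eq_or_ne (‖A s‖ ^ 2) 0 with h0 | h0
  · have := key (-a)
    rw [h0] at this
    nlinarith [sq_nonneg a]
  · have h1 := key (-a / ‖A s‖ ^ 2)
    have h2 : 2 * (-a / ‖A s‖ ^ 2) * a + (-a / ‖A s‖ ^ 2) ^ 2 * ‖A s‖ ^ 2 = -(a ^ 2 / ‖A s‖ ^ 2) := by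
      field_simp; ring
    rw [h2] at h1
    have h3 : 0 ≤ a ^ 2 / ‖A s‖ ^ 2 := by positivity
    have h4 : a ^ 2 / ‖A s‖ ^ 2 = 0 := by linarith
    rcases div_eq_zero_iff.1 h4 with h5 | h5
    · exact pow_eq_zero_iff two_ne_zero |>.1 h5
    · exact absurd h5 h0

theorem IsInexactStep.inner_gradEstimate_eq {ρ η : ℝ} (hρ : 0 < ρ) {A : Euc n →L[ℝ] F} {b : F}
    {K : Submodule ℝ (Euc n)} {s : Euc n} (h : IsInexactStep ρ A b η K s) :
    inner ℝ s (gradEstimate ρ A b) = -(ρ * ‖A s‖ ^ 2) := by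
  have h1 := h.inner_residual hρ
  rw [inner_add_right, real_inner_self_eq_norm_sq] at h1
  rw [inner_gradEstimate, show inner ℝ (A s) b = -‖A s‖ ^ 2 by linarith]
  ring

theorem exists_eigenbasis_adjoint_comp (A : Euc n →L[ℝ] F) :
    ∃ (e : OrthonormalBasis (Fin n) ℝ (Euc n)) (ev : Fin n → ℝ),
      (∀ i, (ContinuousLinearMap.adjoint A) (A (e i)) = ev i • e i) ∧
      (∀ i, 0 ≤ ev i) ∧
      ∀ i, ev i ∈ spectrum ℝ ((ContinuousLinearMap.adjoint A).comp A) := by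
  set B := (ContinuousLinearMap.adjoint A).comp A with hB
  have hsym : (B : Euc n →ₗ[ℝ] Euc n).IsSymmetric := fun x y => by
    simp [hB, ContinuousLinearMap.adjoint_inner_right, ContinuousLinearMap.adjoint_inner_left]
  have hn : Module.finrank ℝ (Euc n) = n := by simp
  set e := hsym.eigenvectorBasis hn
  set ev := hsym.eigenvalues hn
  have he : ∀ i, B (e i) = ev i • e i := fun i => by
    exact hsym.apply_eigenvectorBasis hn i
  have hne : ∀ i, e i ≠ 0 := fun i => e.orthonormal.ne_zero i
  refine ⟨e, ev, fun i => he i, fun i => ?_, fun i => ?_⟩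
  · have h1 : inner ℝ (e i) (B (e i)) = ‖A (e i)‖ ^ 2 := by
      simp [hB, ContinuousLinearMap.adjoint_inner_right]
    rw [he, inner_smul_right, real_inner_self_eq_norm_sq, e.orthonormal.1 i] at h1
    nlinarith [sq_nonneg ‖A (e i)‖]
  · rw [spectrum.mem_iff]
    rintro ⟨u, hu⟩
    have h1 : (u : Euc n →L[ℝ] Euc n) (e i) = 0 := by
      rw [hu]
      simp [Algebra.algebraMap_eq_smul_one, he]
    have h2 : ((↑u⁻¹ : Euc n →L[ℝ] Euc n) * u) (e i) = 0 := by
      rw [mul_apply_eq_comp, h1, map_zero]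
    rw [Units.inv_mul] at h2
    exact hne i (by simpa using h2)

/-- Projecting on the row space does not change `A s` and removes the kernel components, so only
eigenvalues at least `σmin` contribute to the expansion of `‖A q‖²`. -/
theorem SpectralEvent.mul_rowSpaceNorm_sq_le {σmin σmax : ℝ}
    {A : Euc n →L[ℝ] F} (h : SpectralEvent σmin σmax A) (s : Euc n) :
    σmin * rowSpaceNorm A s ^ 2 ≤ ‖A s‖ ^ 2 := by
  obtain ⟨e, ev, he, -, hev⟩ := exists_eigenbasis_adjoint_comp A
  set V := LinearMap.range (ContinuousLinearMap.adjoint A).toLinearMap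
  set q := V.starProjection s with hq
  have hqV : q ∈ V := V.starProjection_apply_mem s
  have hAq : A q = A s := by
    have h1 : s - q ∈ Vᗮ := V.sub_starProjection_mem_orthogonal s
    have h2 : A (s - q) = 0 := by
      rw [← inner_self_eq_zero (𝕜 := ℝ), ← ContinuousLinearMap.adjoint_inner_left]
      exact (Submodule.mem_orthogonal V _).1 h1 _ ⟨A (s - q), rfl⟩
    rw [map_sub, sub_eq_zero] at h2
    exact h2.symm
  -- Eigenvectors for the eigenvalue zero lie in the kernel of `A`, which is orthogonal to the range
  -- of the adjoint.
  have hcoef : ∀ i, ev i = 0 → inner ℝ (e i) q = 0 := by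
    intro i hi
    obtain ⟨y, hy⟩ := hqV
    have h1 : A (e i) = 0 := by
      have : inner ℝ (A (e i)) (A (e i)) = 0 := by
        rw [← ContinuousLinearMap.adjoint_inner_left, he, hi]; simp
      exact inner_self_eq_zero.1 this
    rw [← hy]
    change inner ℝ (e i) ((ContinuousLinearMap.adjoint A) y) = 0
    rw [ContinuousLinearMap.adjoint_inner_right, h1, inner_zero_left]
  have hexp : ‖A q‖ ^ 2 = ∑ i, ev i * inner ℝ (e i) q ^ 2 := by
    rw [← real_inner_self_eq_norm_sq, ← ContinuousLinearMap.adjoint_inner_left,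
      ← e.sum_inner_mul_inner]
    refine Finset.sum_congr rfl fun i _ => ?_
    rw [ContinuousLinearMap.adjoint_inner_left, ← ContinuousLinearMap.adjoint_inner_right, he,
      inner_smul_right, real_inner_comm]
    ring
  have hnorm : ‖q‖ ^ 2 = ∑ i, inner ℝ (e i) q ^ 2 := (e.sum_sq_inner_right q).symm
  change σmin * ‖q‖ ^ 2 ≤ _
  rw [← hAq, hexp, hnorm, Finset.mul_sum]
  refine Finset.sum_le_sum fun i _ => ?_
  by_cases hi : ev i = 0
  · simp [hcoef i hi]
  · exact mul_le_mul_of_nonneg_right (h _ (hev i) hi).1 (sq_nonneg _)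

theorem SpectralEvent.norm_adjoint_comp_le {σmin σmax : ℝ} (hσ : 0 ≤ σmax)
    {A : Euc n →L[ℝ] F} (h : SpectralEvent σmin σmax A) (s : Euc n) :
    ‖(ContinuousLinearMap.adjoint A) (A s)‖ ≤ σmax * ‖s‖ := by
  obtain ⟨e, ev, he, hev0, hev⟩ := exists_eigenbasis_adjoint_comp A
  have hle : ∀ i, ev i ≤ σmax := fun i => by
    by_cases hi : ev i = 0
    · rw [hi]; exact hσ
    · exact (h _ (hev i) hi).2
  refine le_of_sq_le_sq ?_ (by positivity)
  rw [mul_pow, ← e.sum_sq_inner_right, ← e.sum_sq_inner_right s, Finset.mul_sum]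
  refine Finset.sum_le_sum fun i _ => ?_
  rw [ContinuousLinearMap.adjoint_inner_right, ← ContinuousLinearMap.adjoint_inner_left, he,
    inner_smul_left]
  simp only [conj_trivial, mul_pow]
  exact mul_le_mul_of_nonneg_right (pow_le_pow_left₀ (hev0 i) (hle i) 2) (sq_nonneg _)

theorem IsInexactStep.norm_sq_le {ρ η σmin σmax μ : ℝ} (hρ : 0 < ρ) (hσ : 0 < σmin) (hμ : 0 < μ)
    {A : Euc n →L[ℝ] F} {b : F} {K : Submodule ℝ (Euc n)} {s : Euc n}
    (h : IsInexactStep ρ A b η K s) (hspec : SpectralEvent σmin σmax A)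
    (hrow : μ * ‖s‖ ≤ rowSpaceNorm A s) :
    ‖s‖ ^ 2 ≤ kappa₁ ρ σmin μ * -inner ℝ s (gradEstimate ρ A b) := by
  rw [h.inner_gradEstimate_eq hρ, neg_neg, kappa₁, div_mul_eq_mul_div, one_mul,
    le_div_iff₀ (by positivity)]
  have h1 := hspec.mul_rowSpaceNorm_sq_le s
  have h2 : (μ * ‖s‖) ^ 2 ≤ rowSpaceNorm A s ^ 2 := pow_le_pow_left₀ (by positivity) hrow 2
  have h3 : σmin * (μ * ‖s‖) ^ 2 ≤ ‖A s‖ ^ 2 := (mul_le_mul_of_nonneg_left h2 hσ.le).trans h1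
  calc ‖s‖ ^ 2 * (ρ * σmin * μ ^ 2) = ρ * (σmin * (μ * ‖s‖) ^ 2) := by ring
    _ ≤ _ := mul_le_mul_of_nonneg_left h3 hρ.le

/-- By the stopping test, `AᵀA s` accounts for at least the fraction `1 - ηbar` of `Aᵀb`, and its
norm is at most `σmax ‖s‖`. -/
theorem IsInexactStep.kappa₂_mul_norm_le {ρ η ηbar σmin σmax : ℝ} (hρ : 0 < ρ) (hσ : 0 < σmax)
    (hη : η < ηbar) {A : Euc n →L[ℝ] F} {b : F} {K : Submodule ℝ (Euc n)} {s : Euc n}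
    (h : IsInexactStep ρ A b η K s) (hspec : SpectralEvent σmin σmax A) :
    kappa₂ ρ σmax ηbar * ‖gradEstimate ρ A b‖ ≤ ‖s‖ := by
  have h1 := hspec.norm_adjoint_comp_le hσ.le s
  have h2 := h.2.2
  set a := (ContinuousLinearMap.adjoint A) b with ha
  have h3 : ‖a‖ ≤ ‖(ContinuousLinearMap.adjoint A) (A s + b)‖ +
      ‖(ContinuousLinearMap.adjoint A) (A s)‖ := by
    have : a = (ContinuousLinearMap.adjoint A) (A s + b) - (ContinuousLinearMap.adjoint A) (A s) := by
      rw [map_add]; abel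
    calc ‖a‖ = _ := congrArg norm this
      _ ≤ _ := norm_sub_le _ _
  have h4 : η * ‖a‖ ≤ ηbar * ‖a‖ := mul_le_mul_of_nonneg_right hη.le (norm_nonneg _)
  rw [kappa₂, gradEstimate, norm_smul, Real.norm_of_nonneg hρ.le, ← ha, div_mul_eq_mul_div,
    div_le_iff₀ (by positivity)]
  have h5 : (1 - ηbar) * ‖a‖ ≤ σmax * ‖s‖ := by linarith
  nlinarith

end Step

/-! ### Gradient of the objective and accuracy of sampled Jacobians. -/

section Objective

variable {n : ℕ} {F : Type*} [NormedAddCommGroup F] [InnerProductSpace ℝ F] [CompleteSpace F]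

theorem hasGradientAt_objective (ρ : ℝ) {R : Euc n → F} {x : Euc n}
    (hR : DifferentiableAt ℝ R x) :
    HasGradientAt (objective ρ R) (gradEstimate ρ (fderiv ℝ R x) (R x)) x := by
  rw [hasGradientAt_iff_hasFDerivAt]
  have h := (hR.hasFDerivAt.norm_sq).const_mul (ρ / 2)
  refine h.congr_fderiv ?_
  ext v
  simp [gradEstimate, ContinuousLinearMap.adjoint_inner_left]
  ring

/-- The error is `ρ (J - A)ᵀ R(x)`, and the bound by `κ₃` trades `‖R(x)‖` for the norm of the
gradient estimate. Jacobian accuracy thus becomes the relative gradient accuracy assumed for row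
compression, with `β = α κ₃`. -/
theorem norm_gradient_objective_sub_gradEstimate_le {ρ κ₃ d : ℝ} (hρ : 0 < ρ) (hκ₃ : 0 < κ₃)
    {R : Euc n → F} {x : Euc n} (hR : DifferentiableAt ℝ R x) {A : Euc n →L[ℝ] F}
    (hA : ‖fderiv ℝ R x - A‖ ≤ d)
    (hκ : 1 / κ₃ * ‖R x‖ ≤ ‖(ContinuousLinearMap.adjoint A) (R x)‖) :
    ‖gradient (objective ρ R) x - gradEstimate ρ A (R x)‖ ≤
      d * κ₃ * ‖gradEstimate ρ A (R x)‖ := by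
  have hd : 0 ≤ d := (norm_nonneg _).trans hA
  have h0 : ‖R x‖ ≤ κ₃ * ‖(ContinuousLinearMap.adjoint A) (R x)‖ := by
    rwa [one_div, inv_mul_le_iff₀ hκ₃] at hκ
  have h1 : gradEstimate ρ (fderiv ℝ R x) (R x) - gradEstimate ρ A (R x) =
      ρ • (ContinuousLinearMap.adjoint (fderiv ℝ R x - A)) (R x) := by
    simp [gradEstimate, smul_sub, map_sub]
  rw [(hasGradientAt_objective ρ hR).gradient, h1, norm_smul, gradEstimate, norm_smul,
    Real.norm_of_nonneg hρ.le]
  have h2 : ‖(ContinuousLinearMap.adjoint (fderiv ℝ R x - A)) (R x)‖ ≤ d * ‖R x‖ := by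
    refine (ContinuousLinearMap.le_opNorm _ _).trans ?_
    rw [LinearIsometryEquiv.norm_map]
    exact mul_le_mul_of_nonneg_right hA (norm_nonneg _)
  calc _ ≤ ρ * (d * (κ₃ * ‖(ContinuousLinearMap.adjoint A) (R x)‖)) := by gcongr; exact h2.trans (by gcongr)
    _ = _ := by ring

end Objective

/-! ### The descent lemma. -/

section Smooth

variable {E : Type*} [NormedAddCommGroup E] [InnerProductSpace ℝ E] [CompleteSpace E]

theorem le_add_inner_gradient_add_of_lipschitz {f : E → ℝ} (hf : Differentiable ℝ f) {L : ℝ}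
    (hL : ∀ x y, ‖gradient f x - gradient f y‖ ≤ L * ‖x - y‖) (x d : E) :
    f (x + d) ≤ f x + inner ℝ (gradient f x) d + L / 2 * ‖d‖ ^ 2 := by
  -- The claim is `φ 1 ≤ φ 0`; the Lipschitz bound makes the derivative of `φ` nonpositive on the
  -- unit interval.
  set φ : ℝ → ℝ := fun t => f (x + t • d) - t * inner ℝ (gradient f x) d - L / 2 * ‖d‖ ^ 2 * t ^ 2
    with hφ
  have hderiv : ∀ t, HasDerivAt φ
      (inner ℝ (gradient f (x + t • d)) d - inner ℝ (gradient f x) d -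
        L / 2 * ‖d‖ ^ 2 * (2 * t)) t := by
    intro t
    have h1 : HasDerivAt (fun t : ℝ => x + t • d) d t := by
      simpa using ((hasDerivAt_id t).smul_const d).const_add x
    have h2 := ((hf (x + t • d)).hasGradientAt.hasFDerivAt).comp_hasDerivAt t h1
    have h3 := (hasDerivAt_id t).mul_const (inner ℝ (gradient f x) d)
    have h4 := (hasDerivAt_pow 2 t).const_mul (L / 2 * ‖d‖ ^ 2)
    refine ((h2.sub h3).sub h4).congr_deriv ?_
    simp
  have hanti : AntitoneOn φ (Set.Icc 0 1) := by
    refine antitoneOn_of_deriv_nonpos (convex_Icc 0 1)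
      (fun t _ => (hderiv t).continuousAt.continuousWithinAt)
      (fun t _ => (hderiv t).differentiableAt.differentiableWithinAt) fun t ht => ?_
    rw [interior_Icc] at ht
    rw [(hderiv t).deriv, ← inner_sub_left]
    have h1 := real_inner_le_norm (gradient f (x + t • d) - gradient f x) d
    have h2 := hL (x + t • d) x
    rw [add_sub_cancel_left, norm_smul, Real.norm_of_nonneg ht.1.le] at h2
    have h3 := mul_le_mul_of_nonneg_right h2 (norm_nonneg d)
    nlinarith
  have h := hanti (Set.left_mem_Icc.2 zero_le_one) (Set.right_mem_Icc.2 zero_le_one) zero_le_one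
  simp only [hφ, one_smul, zero_smul, add_zero] at h
  linarith

end Smooth

/-! ### Expected hitting times from a drift condition. -/

theorem toENNReal_le_tsum_ite (N : ℕ∞) :
    (N : ℝ≥0∞) ≤ ∑' k : ℕ, if (k : ℕ∞) < N then 1 else 0 := by
  induction N using ENat.recTopCoe with
  | top => simp
  | coe n =>
    refine le_trans ?_ (ENNReal.sum_le_tsum (Finset.range n))
    rw [Finset.sum_congr rfl fun k hk => if_pos (by exact_mod_cast Finset.mem_range.1 hk)]
    simp

/-- No measurability of `A` is assumed: the conditional expectation of a non-integrable function is
zero by convention, which the positive lower bound excludes. -/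
theorem integrable_indicator_one_of_le_condExp {Ω : Type*} {m mΩ : MeasurableSpace Ω} {P : Measure Ω}
    [IsProbabilityMeasure P] {p : ℝ} (hp : 0 < p)
    {A : Set Ω} (h : ∀ᵐ ω ∂P, p ≤ (P⟦A | m⟧) ω) :
    Integrable (A.indicator fun _ => (1 : ℝ)) P := by
  by_contra hint
  rw [condExp_of_not_integrable hint] at h
  obtain ⟨ω, hω⟩ := h.exists
  exact absurd hω (not_le.2 hp)

theorem mul_measureReal_le_setIntegral_of_le_condExp {Ω : Type*} {m mΩ : MeasurableSpace Ω}
    {P : Measure Ω} [IsProbabilityMeasure P] (hm : m ≤ mΩ)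
    {p : ℝ} (hp : 0 < p) {A B : Set Ω} (hB : MeasurableSet[m] B)
    (h : ∀ᵐ ω ∂P, p ≤ (P⟦A | m⟧) ω) :
    p * P.real B ≤ ∫ ω in B, A.indicator (fun _ => (1 : ℝ)) ω ∂P := by
  rw [← setIntegral_condExp hm (integrable_indicator_one_of_le_condExp hp h) hB]
  have h1 : ∫ _ in B, p ∂P = p * P.real B := by
    rw [setIntegral_const, smul_eq_mul, mul_comm]
  rw [← h1]
  exact integral_mono_ae (integrable_const _) integrable_condExp.integrableOn
    (ae_restrict_of_ae h)

section Drift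

variable {Ω : Type*} [mΩ : MeasurableSpace Ω] {P : Measure Ω} [IsProbabilityMeasure P]

/-- If, before the time `N`, a nonnegative process decreases by at least one at the iterations of
conditional probability at least `p > 1 / 2`, and increases by at most one at the other iterations,
then the expectation of `N` is at most the initial value divided by the drift `2 p - 1`. -/
theorem lintegral_le_of_drift (ℱ : Filtration ℕ mΩ) {N : Ω → ℕ∞}
    (hN : ∀ k : ℕ, MeasurableSet[ℱ k] {ω | (k : ℕ∞) < N ω}) {A : ℕ → Set Ω} {p : ℝ}
    (hp : 1 / 2 < p) (hA : ∀ k, ∀ᵐ ω ∂P, p ≤ (P⟦A k | ℱ k⟧) ω) {W : ℕ → Ω → ℝ} {w : ℝ}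
    (hW0 : ∀ ω, W 0 ω ≤ w) (hW : ∀ k ω, 0 ≤ W k ω)
    (hstep : ∀ᵐ ω ∂P, ∀ k : ℕ, (k : ℕ∞) < N ω →
      W (k + 1) ω ≤ W k ω + 1 ∧ (ω ∈ A k → W (k + 1) ω ≤ W k ω - 1)) :
    ∫⁻ ω, (N ω : ℝ≥0∞) ∂P ≤ ENNReal.ofReal (w / (2 * p - 1)) := by
  set B : ℕ → Set Ω := fun k => {ω | (k : ℕ∞) < N ω} with hBdef
  have hB : ∀ k, MeasurableSet (B k) := fun k => ℱ.le k _ (hN k)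
  -- `D k` is `+1` on `A k` and `-1` off it, stopped at `N`. Integrating `D` in place of the
  -- increments of `W` avoids any measurability or integrability of `W`.
  set D : ℕ → Ω → ℝ := fun k => (B k).indicator fun ω => 2 * (A k).indicator (fun _ => (1 : ℝ)) ω - 1
    with hD
  have hAint : ∀ k, Integrable ((A k).indicator fun _ => (1 : ℝ)) P := fun k =>
    integrable_indicator_one_of_le_condExp (by linarith) (hA k)
  have hDint : ∀ k, Integrable (D k) P := fun k =>
    (((hAint k).const_mul 2).sub (integrable_const 1)).indicator (hB k)
  have hDE : ∀ k, (2 * p - 1) * P.real (B k) ≤ ∫ ω, D k ω ∂P := by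
    intro k
    have h1 := mul_measureReal_le_setIntegral_of_le_condExp (ℱ.le k) (by linarith) (hN k) (hA k)
    rw [hD, integral_indicator (hB k),
      integral_sub ((hAint k).const_mul 2).integrableOn (integrable_const _),
      integral_const_mul, setIntegral_const, smul_eq_mul, mul_one]
    change p * P.real (B k) ≤ _ at h1
    linarith
  have hpath : ∀ᵐ ω ∂P, ∀ n : ℕ, ∑ k ∈ Finset.range n, D k ω ≤ w := by
    filter_upwards [hstep] with ω hω n
    -- The bound containing `W n` is available only up to time `N`; afterwards `D` vanishes, so the
    -- bound on the sum alone persists.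
    have hind : ∀ n : ℕ, (∑ k ∈ Finset.range n, D k ω ≤ w) ∧
        ((n : ℕ∞) ≤ N ω → ∑ k ∈ Finset.range n, D k ω + W n ω ≤ w) := by
      intro n
      induction n with
      | zero =>
        have h0 := hW0 ω
        have h1 := hW 0 ω
        exact ⟨by simpa using h1.trans h0, fun _ => by simpa using h0⟩
      | succ n ih =>
        rw [Finset.sum_range_succ]
        by_cases hn : (n : ℕ∞) < N ω
        · have h1 := ih.2 hn.le
          obtain ⟨h2, h3⟩ := hω n hn
          have h4 : D n ω + W (n + 1) ω ≤ W n ω := by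
            have hmem : ω ∈ B n := hn
            simp only [hD, Set.indicator_of_mem hmem]
            by_cases hωA : ω ∈ A n
            · rw [Set.indicator_of_mem hωA]; linarith [h3 hωA]
            · rw [Set.indicator_of_notMem hωA]; linarith
          have h5 := hW (n + 1) ω
          exact ⟨by linarith, fun _ => by linarith⟩
        · have hmem : ω ∉ B n := hn
          have h1 : D n ω = 0 := Set.indicator_of_notMem hmem _
          rw [h1, add_zero]
          refine ⟨ih.1, fun h => absurd (lt_of_lt_of_le ?_ h) hn⟩
          exact_mod_cast Nat.lt_succ_self n
    exact (hind n).1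
  have hsum : ∀ n : ℕ, ∑ k ∈ Finset.range n, P.real (B k) ≤ w / (2 * p - 1) := by
    intro n
    rw [le_div_iff₀ (by linarith), mul_comm, Finset.mul_sum]
    calc _ ≤ ∑ k ∈ Finset.range n, ∫ ω, D k ω ∂P := Finset.sum_le_sum fun k _ => hDE k
      _ = ∫ ω, ∑ k ∈ Finset.range n, D k ω ∂P := (integral_finsetSum _ fun k _ => hDint k).symm
      _ ≤ ∫ _, w ∂P := integral_mono_ae (integrable_finsetSum _ fun k _ => hDint k)
          (integrable_const _) (hpath.mono fun ω h => h n)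
      _ = w := by simp
  have hlint : ∫⁻ ω, (N ω : ℝ≥0∞) ∂P ≤ ∑' k, P (B k) := by
    calc _ ≤ ∫⁻ ω, ∑' k : ℕ, (B k).indicator 1 ω ∂P := by
          refine lintegral_mono fun ω => (toENNReal_le_tsum_ite (N ω)).trans_eq ?_
          refine tsum_congr fun k => ?_
          simp [Set.indicator_apply, hBdef]
      _ = ∑' k, P (B k) := by
          rw [lintegral_tsum fun k => (measurable_one.indicator (hB k)).aemeasurable]
          exact tsum_congr fun k => lintegral_indicator_one (hB k)
  refine hlint.trans (ENNReal.tsum_le_of_sum_range_le fun n => ?_)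
  rw [← ENNReal.ofReal_toReal (ENNReal.sum_ne_top.2 fun k _ => measure_ne_top P (B k)),
    ENNReal.toReal_sum fun k _ => measure_ne_top P (B k)]
  exact ENNReal.ofReal_le_ofReal (hsum n)

end Drift

/-! ### Acceptance of short steps and decrease of the objective at true iterations. -/

section Decrease

variable {E : Type*} [NormedAddCommGroup E] [InnerProductSpace ℝ E] [CompleteSpace E]

/-- In the descent lemma, the gradient error costs at most `β t² ‖s‖² / κ₂` and the curvature `L t²
‖s‖² / 2`. With `‖s‖² ≤ κ₁ a`, where `a = -sᵀg`, their sum is at most `(1 - c) t a` exactly when `t`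
is below the threshold. -/
theorem line_search_accepts {f : E → ℝ} (hf : Differentiable ℝ f) {L : ℝ} (hL0 : 0 ≤ L)
    (hL : ∀ x y, ‖gradient f x - gradient f y‖ ≤ L * ‖x - y‖) {c κ₁ κ₂ β t : ℝ} {x s g : E}
    (hκ₁ : 0 < κ₁) (hκ₂ : 0 < κ₂) (hβ : 0 < β) (ht : 0 < t)
    (hs : ‖s‖ ^ 2 ≤ κ₁ * -inner ℝ s g) (hg : κ₂ * ‖g‖ ≤ ‖s‖)
    (hacc : ‖gradient f x - g‖ ≤ β * t * ‖g‖) (hθ : t ≤ stepThreshold c κ₁ κ₂ β L) :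
    f (x + t • s) ≤ f x + c * t * inner ℝ s g := by
  have hfx := le_add_inner_gradient_add_of_lipschitz hf hL x (t • s)
  rw [inner_smul_right, norm_smul, Real.norm_of_nonneg ht.le] at hfx
  rw [stepThreshold, le_div_iff₀ (by positivity)] at hθ
  have h1 : inner ℝ (gradient f x) s ≤ inner ℝ s g + β * t * ‖g‖ * ‖s‖ := by
    have h2 := real_inner_le_norm (gradient f x - g) s
    rw [inner_sub_left, real_inner_comm s g] at h2
    have h3 := mul_le_mul_of_nonneg_right hacc (norm_nonneg s)
    linarith
  set a : ℝ := -inner ℝ s g with ha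
  have hai : inner ℝ s g = -a := by rw [ha, neg_neg]
  rw [hai] at h1 ⊢
  have ha0 : 0 ≤ a := by
    by_contra hneg
    nlinarith [sq_nonneg ‖s‖, mul_pos hκ₁ (neg_pos.2 (not_le.1 hneg))]
  have h4 : κ₂ * (‖g‖ * ‖s‖) ≤ ‖s‖ ^ 2 := by nlinarith [norm_nonneg s]
  have h5 : t * ‖s‖ ^ 2 * (κ₂ * L + 2 * β) ≤ 2 * (1 - c) * κ₂ * a := by
    calc t * ‖s‖ ^ 2 * (κ₂ * L + 2 * β) ≤ t * (κ₁ * a) * (κ₂ * L + 2 * β) := by gcongr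
      _ = t * ((κ₂ * L + 2 * β) * κ₁) * a := by ring
      _ ≤ _ := mul_le_mul_of_nonneg_right hθ ha0
  have h6 : κ₂ * (β * t * ‖g‖ * ‖s‖) ≤ β * t * ‖s‖ ^ 2 := by
    have := mul_le_mul_of_nonneg_left h4 (by positivity : 0 ≤ β * t)
    linarith
  have h7 : β * t * ‖g‖ * ‖s‖ + L / 2 * t * ‖s‖ ^ 2 ≤ (1 - c) * a := by
    refine le_of_mul_le_mul_left ?_ hκ₂
    linarith
  have h8 := mul_le_mul_of_nonneg_left h7 ht.le
  have h9 := mul_le_mul_of_nonneg_left h1 ht.le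
  nlinarith

/-- The chain is `ε ≤ (1 + β tmax) ‖g‖`, `κ₂ ‖g‖ ≤ ‖s‖`, `‖s‖² ≤ κ₁ (-sᵀg)`, and then the acceptance
test. -/
theorem decrease_of_accepted {f : E → ℝ} {c κ₁ κ₂ β t tbar tmax ε : ℝ} {x x' s g : E}
    (hc : 0 < c) (hκ₁ : 0 < κ₁) (hκ₂ : 0 < κ₂) (hβ : 0 < β) (ht : 0 < t) (hε : 0 < ε)
    (htbar : tbar ≤ t) (htmax : t ≤ tmax)
    (hs : ‖s‖ ^ 2 ≤ κ₁ * -inner ℝ s g) (hg : κ₂ * ‖g‖ ≤ ‖s‖)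
    (hacc : ‖gradient f x - g‖ ≤ β * t * ‖g‖) (hgrad : ε ≤ ‖gradient f x‖)
    (hx' : f x' ≤ f x + c * t * inner ℝ s g) :
    c * κ₂ ^ 2 * tbar * ε ^ 2 / (κ₁ * (1 + β * tmax) ^ 2) ≤ f x - f x' := by
  have hmax : 0 < 1 + β * tmax := by nlinarith [mul_pos hβ (ht.trans_le htmax)]
  have h1 : ε ≤ (1 + β * tmax) * ‖g‖ := by
    have h2 : ‖gradient f x‖ ≤ ‖gradient f x - g‖ + ‖g‖ := by
      simpa using norm_add_le (gradient f x - g) g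
    have h3 : β * t * ‖g‖ ≤ β * tmax * ‖g‖ := by gcongr
    linarith
  have h4 : κ₂ * ε ≤ (1 + β * tmax) * ‖s‖ := by nlinarith
  have h5 : (κ₂ * ε) ^ 2 ≤ (1 + β * tmax) ^ 2 * (κ₁ * -inner ℝ s g) := by
    calc (κ₂ * ε) ^ 2 ≤ ((1 + β * tmax) * ‖s‖) ^ 2 := pow_le_pow_left₀ (by positivity) h4 2
      _ = (1 + β * tmax) ^ 2 * ‖s‖ ^ 2 := by ring
      _ ≤ _ := by gcongr
  rw [div_le_iff₀ (by positivity)]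
  have h6 : c * t * -inner ℝ s g ≤ f x - f x' := by linarith
  calc c * κ₂ ^ 2 * tbar * ε ^ 2 ≤ c * κ₂ ^ 2 * t * ε ^ 2 := by gcongr
    _ = c * t * (κ₂ * ε) ^ 2 := by ring
    _ ≤ c * t * ((1 + β * tmax) ^ 2 * (κ₁ * -inner ℝ s g)) := by gcongr
    _ = (c * t * -inner ℝ s g) * (κ₁ * (1 + β * tmax) ^ 2) := by ring
    _ ≤ _ := mul_le_mul_of_nonneg_right h6 (by positivity)

end Decrease

/-! ### Integer levels of step-lengths. -/

section Level

/-- The number of reductions by the factor `τ` that lead from the step-length `t` to `tbar`, rounded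
down; it is negative for `t < tbar`. -/
noncomputable def stepLevel (τ tbar t : ℝ) : ℤ := ⌊Real.logb τ (tbar / t)⌋

variable {τ tbar t : ℝ}

theorem stepLevel_mul (hτ : 0 < τ ∧ τ < 1) (hbar : 0 < tbar) (ht : 0 < t) :
    stepLevel τ tbar (τ * t) = stepLevel τ tbar t - 1 := by
  have h : tbar / (τ * t) = tbar / t / τ := by field_simp
  rw [stepLevel, h, Real.logb_div (by positivity) hτ.1.ne',
    Real.logb_self_eq_one_iff.2 ⟨hτ.1.ne', hτ.2.ne, by linarith⟩, Int.floor_sub_one, stepLevel]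

theorem stepLevel_inv_mul (hτ : 0 < τ ∧ τ < 1) (hbar : 0 < tbar) (ht : 0 < t) :
    stepLevel τ tbar (τ⁻¹ * t) = stepLevel τ tbar t + 1 := by
  have h := stepLevel_mul hτ hbar (mul_pos (inv_pos.2 hτ.1) ht)
  rw [mul_inv_cancel_left₀ hτ.1.ne'] at h
  omega

theorem stepLevel_mono (hτ : 0 < τ ∧ τ < 1) (hbar : 0 < tbar) (ht : 0 < t) {t' : ℝ}
    (h : t ≤ t') : stepLevel τ tbar t ≤ stepLevel τ tbar t' := by
  refine Int.floor_mono ((Real.logb_le_logb_of_base_lt_one hτ.1 hτ.2 (by positivity)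
    (div_pos hbar (ht.trans_le h))).2 ?_)
  gcongr

theorem stepLevel_nonneg_iff (hτ : 0 < τ ∧ τ < 1) (hbar : 0 < tbar) (ht : 0 < t) :
    0 ≤ stepLevel τ tbar t ↔ tbar ≤ t := by
  rw [stepLevel, Int.floor_nonneg, Real.logb_nonneg_iff_of_base_lt_one hτ.1 hτ.2 (by positivity),
    div_le_one ht]

theorem lt_of_stepLevel_nonpos (hτ : 0 < τ ∧ τ < 1) (hbar : 0 < tbar) (ht : 0 < t)
    (h : stepLevel τ tbar t ≤ 0) : τ * t < tbar := by
  by_contra hlt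
  have h1 := (stepLevel_nonneg_iff hτ hbar (mul_pos hτ.1 ht)).2 (not_lt.1 hlt)
  rw [stepLevel_mul hτ hbar ht] at h1
  omega

end Level

/-! ### Pathwise behaviour of the line search, and its expected complexity. -/

section LineSearch

variable {n : ℕ} {Ω : Type*} {f : Euc n → ℝ} {c τ tmax t₀ : ℝ} {x₀ : Euc n}
  {X : ℕ → Ω → Euc n} {T : ℕ → Ω → ℝ} {S G : ℕ → Ω → Euc n}

theorem IsLineSearchRun.stepLength_mem (run : IsLineSearchRun f c τ tmax t₀ x₀ X T S G)
    (hτ : 0 < τ ∧ τ < 1) (ht₀ : 0 < t₀ ∧ t₀ ≤ tmax) (k : ℕ) (ω : Ω) :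
    0 < T k ω ∧ T k ω ≤ tmax := by
  induction k with
  | zero => rw [run.T_zero]; exact ht₀
  | succ k ih =>
    by_cases h : f (X k ω + T k ω • S k ω) ≤ f (X k ω) + c * T k ω * inner ℝ (S k ω) (G k ω)
    · rw [(run.successful k ω h).2]
      exact ⟨lt_min (ht₀.1.trans_le ht₀.2) (mul_pos (inv_pos.2 hτ.1) ih.1), min_le_left _ _⟩
    · rw [(run.unsuccessful k ω h).2]
      exact ⟨mul_pos hτ.1 ih.1, (mul_le_of_le_one_left ih.1.le hτ.2.le).trans ih.2⟩

theorem IsLineSearchRun.exists_stepLength_eq (run : IsLineSearchRun f c τ tmax t₀ x₀ X T S G)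
    (hτ : 0 < τ ∧ τ < 1) (hmax : 0 < tmax) (hgrid : ∃ i : ℕ, t₀ = tmax * τ ^ i) (k : ℕ) (ω : Ω) :
    ∃ i : ℕ, T k ω = tmax * τ ^ i := by
  induction k with
  | zero => rw [run.T_zero]; exact hgrid
  | succ k ih =>
    obtain ⟨i, hi⟩ := ih
    by_cases h : f (X k ω + T k ω • S k ω) ≤ f (X k ω) + c * T k ω * inner ℝ (S k ω) (G k ω)
    · rw [(run.successful k ω h).2, hi]
      cases i with
      | zero =>
        refine ⟨0, ?_⟩
        rw [pow_zero, mul_one, min_eq_left]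
        exact le_mul_of_one_le_left hmax.le ((one_le_inv₀ hτ.1).2 hτ.2.le)
      | succ i =>
        refine ⟨i, ?_⟩
        have h1 : τ⁻¹ * (tmax * τ ^ (i + 1)) = tmax * τ ^ i := by
          rw [pow_succ']
          have := hτ.1.ne'
          field_simp
        rw [h1, min_eq_right]
        exact mul_le_of_le_one_right hmax.le (pow_le_one₀ hτ.1.le hτ.2.le)
    · rw [(run.unsuccessful k ω h).2, hi]
      exact ⟨i + 1, by ring⟩

/-- A nonpositive level means `τ * T k < tbar`. If `tbar ≤ τ θ`, cancel `τ`. On the grid, `T k` and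
`tbar` are both `tmax` times powers of `τ`, so the strict inequality sharpens to `T k ≤ tbar ≤ θ`.
-/
theorem IsLineSearchRun.stepLength_le_threshold
    (run : IsLineSearchRun f c τ tmax t₀ x₀ X T S G) (hτ : 0 < τ ∧ τ < 1)
    (ht₀ : 0 < t₀ ∧ t₀ ≤ tmax) {θ tbar : ℝ} (hadm : IsAdmissible τ tmax t₀ θ tbar) {k : ℕ} {ω : Ω}
    (h : stepLevel τ tbar (T k ω) ≤ 0) : T k ω ≤ θ := by
  obtain ⟨hbar, -, hcase⟩ := hadm
  have hT := (run.stepLength_mem hτ ht₀ k ω).1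
  have hlt := lt_of_stepLevel_nonpos hτ hbar hT h
  rcases hcase with ⟨hθ, ⟨j, hj⟩, i₀, hi₀⟩ | hθ
  · have hmax : 0 < tmax := ht₀.1.trans_le ht₀.2
    obtain ⟨i, hi⟩ := run.exists_stepLength_eq hτ hmax ⟨i₀, hi₀⟩ k ω
    refine le_trans ?_ hθ
    have h1 : tbar = tmax * τ ^ (i₀ + j) := by rw [hj, hi₀]; ring
    rw [hi, h1] at hlt ⊢
    have h2 : τ ^ (i + 1) < τ ^ (i₀ + j) := by
      refine lt_of_mul_lt_mul_left ?_ hmax.le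
      calc tmax * τ ^ (i + 1) = τ * (tmax * τ ^ i) := by ring
        _ < _ := hlt
    have h3 : i₀ + j < i + 1 := (pow_lt_pow_iff_right_of_lt_one₀ hτ.1 hτ.2).1 h2
    exact mul_le_mul_of_nonneg_left (pow_le_pow_of_le_one hτ.1.le hτ.2.le (by omega)) hmax.le
  · exact le_of_mul_le_mul_left (hlt.le.trans hθ) hτ.1

theorem IsLineSearchRun.abs_stepLevel_succ_le
    (run : IsLineSearchRun f c τ tmax t₀ x₀ X T S G) (hτ : 0 < τ ∧ τ < 1)
    (ht₀ : 0 < t₀ ∧ t₀ ≤ tmax) {tbar : ℝ} (hbar : 0 < tbar) (hlt : tbar < t₀) (k : ℕ) (ω : Ω) :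
    |stepLevel τ tbar (T (k + 1) ω)| ≤ |stepLevel τ tbar (T k ω)| + 1 ∧
    (f (X k ω + T k ω • S k ω) ≤ f (X k ω) + c * T k ω * inner ℝ (S k ω) (G k ω) →
      stepLevel τ tbar (T k ω) < 0 →
      |stepLevel τ tbar (T (k + 1) ω)| ≤ |stepLevel τ tbar (T k ω)| - 1) ∧
    (¬ f (X k ω + T k ω • S k ω) ≤ f (X k ω) + c * T k ω * inner ℝ (S k ω) (G k ω) →
      0 < stepLevel τ tbar (T k ω) →
      |stepLevel τ tbar (T (k + 1) ω)| ≤ |stepLevel τ tbar (T k ω)| - 1) := by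
  obtain ⟨hT, hTmax⟩ := run.stepLength_mem hτ ht₀ k ω
  by_cases h : f (X k ω + T k ω • S k ω) ≤ f (X k ω) + c * T k ω * inner ℝ (S k ω) (G k ω)
  · have hmax := (stepLevel_nonneg_iff hτ hbar (ht₀.1.trans_le ht₀.2)).2 (hlt.le.trans ht₀.2)
    have hle := stepLevel_mono hτ hbar hT hTmax
    have hinv := stepLevel_inv_mul hτ hbar hT
    have hv : stepLevel τ tbar (T (k + 1) ω) =
        min (stepLevel τ tbar tmax) (stepLevel τ tbar (T k ω) + 1) := by
      rw [(run.successful k ω h).2, ← hinv]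
      rcases le_total tmax (τ⁻¹ * T k ω) with h1 | h1
      · rw [min_eq_left h1, min_eq_left (stepLevel_mono hτ hbar (ht₀.1.trans_le ht₀.2) h1)]
      · rw [min_eq_right h1,
          min_eq_right (stepLevel_mono hτ hbar (mul_pos (inv_pos.2 hτ.1) hT) h1)]
    rw [hv]
    refine ⟨?_, fun _ _ => ?_, fun h' => absurd h h'⟩ <;> grind
  · have hv : stepLevel τ tbar (T (k + 1) ω) = stepLevel τ tbar (T k ω) - 1 := by
      rw [(run.unsuccessful k ω h).2, stepLevel_mul hτ hbar hT]
    rw [hv]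
    refine ⟨?_, fun h' => absurd h' h, fun _ _ => ?_⟩ <;> grind

theorem IsLineSearchRun.objective_succ_le (run : IsLineSearchRun f c τ tmax t₀ x₀ X T S G)
    (hc : 0 < c) (hτ : 0 < τ ∧ τ < 1) (ht₀ : 0 < t₀ ∧ t₀ ≤ tmax) {k : ℕ} {ω : Ω}
    (hdesc : inner ℝ (S k ω) (G k ω) ≤ 0) : f (X (k + 1) ω) ≤ f (X k ω) := by
  by_cases h : f (X k ω + T k ω • S k ω) ≤ f (X k ω) + c * T k ω * inner ℝ (S k ω) (G k ω)
  · rw [(run.successful k ω h).1]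
    have hT := (run.stepLength_mem hτ ht₀ k ω).1
    have := mul_nonpos_of_nonneg_of_nonpos (mul_pos hc hT).le hdesc
    linarith
  · rw [(run.unsuccessful k ω h).1]

theorem lt_hittingTime_iff {ε : ℝ} {k : ℕ} {ω : Ω} :
    (k : ℕ∞) < hittingTime f X ε ω ↔ ∀ i ≤ k, ε < ‖gradient f (X i ω)‖ := by
  rw [← ENat.add_one_le_iff (ENat.natCast_ne_top k), hittingTime, le_iInf_iff]
  constructor
  · intro h i hi
    by_contra hlt
    have h1 := h ⟨i, not_lt.1 hlt⟩
    have h2 : k + 1 ≤ i := by exact_mod_cast h1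
    omega
  · rintro h ⟨i, hi⟩
    have h1 : ¬ i ≤ k := fun hik => absurd hi (not_le.2 (h i hik))
    exact_mod_cast (by omega : k + 1 ≤ i)

variable [mΩ : MeasurableSpace Ω]

/-- The acceptance test sees `G k` only through its inner product with `S k`. Measurability of that
product may depend on that of `X k`, which the induction supplies. -/
theorem IsLineSearchRun.measurable_iterates (run : IsLineSearchRun f c τ tmax t₀ x₀ X T S G)
    {ℱ : Filtration ℕ mΩ} (hf : Continuous f) (hS : ∀ k, Measurable[ℱ (k + 1)] (S k))
    (hSG : ∀ k, Measurable[ℱ (k + 1)] (X k) →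
      Measurable[ℱ (k + 1)] fun ω => inner ℝ (S k ω) (G k ω)) (k : ℕ) :
    Measurable[ℱ k] (X k) ∧ Measurable[ℱ k] (T k) := by
  induction k with
  | zero =>
    rw [show X 0 = fun _ => x₀ from funext run.X_zero, show T 0 = fun _ => t₀ from funext run.T_zero]
    exact ⟨measurable_const, measurable_const⟩
  | succ k ih =>
    have hle := ℱ.mono (Nat.le_succ k)
    have hX : Measurable[ℱ (k + 1)] (X k) := ih.1.mono hle le_rfl
    have hT : Measurable[ℱ (k + 1)] (T k) := ih.2.mono hle le_rfl
    have hSG' := hSG k hX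
    have hS' := hS k
    have hnew : Measurable[ℱ (k + 1)] fun ω => X k ω + T k ω • S k ω := hX.add (hT.smul hS')
    have hset : MeasurableSet[ℱ (k + 1)] {ω | f (X k ω + T k ω • S k ω) ≤
        f (X k ω) + c * T k ω * inner ℝ (S k ω) (G k ω)} :=
      measurableSet_le (hf.measurable.comp hnew)
        ((hf.measurable.comp hX).add ((hT.const_mul c).mul hSG'))
    classical
    have hX1 : X (k + 1) = fun ω => if ω ∈ {ω | f (X k ω + T k ω • S k ω) ≤
        f (X k ω) + c * T k ω * inner ℝ (S k ω) (G k ω)} then X k ω + T k ω • S k ω else X k ω := by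
      funext ω
      split_ifs with h
      · exact (run.successful k ω h).1
      · exact (run.unsuccessful k ω h).1
    have hT1 : T (k + 1) = fun ω => if ω ∈ {ω | f (X k ω + T k ω • S k ω) ≤
        f (X k ω) + c * T k ω * inner ℝ (S k ω) (G k ω)} then min tmax (τ⁻¹ * T k ω)
        else τ * T k ω := by
      funext ω
      split_ifs with h
      · exact (run.successful k ω h).2
      · exact (run.unsuccessful k ω h).2
    rw [hX1, hT1]
    exact ⟨Measurable.ite hset hnew hX,
      Measurable.ite hset (measurable_const.min (hT.const_mul _)) (hT.const_mul _)⟩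

theorem measurableSet_lt_hittingTime {ℱ : Filtration ℕ mΩ} (hf : Continuous (gradient f))
    (hX : ∀ k, Measurable[ℱ k] (X k)) (ε : ℝ) (k : ℕ) :
    MeasurableSet[ℱ k] {ω | (k : ℕ∞) < hittingTime f X ε ω} := by
  have h : {ω | (k : ℕ∞) < hittingTime f X ε ω} =
      ⋂ i ∈ Set.Iic k, {ω | ε < ‖gradient f (X i ω)‖} := by
    ext ω
    simp [lt_hittingTime_iff]
  rw [h]
  refine MeasurableSet.biInter (Set.to_countable _) fun i hi => ?_
  have h1 : Measurable[ℱ k] (X i) := (hX i).mono (ℱ.mono hi) le_rfl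
  exact measurableSet_lt measurable_const (hf.norm.measurable.comp h1)

/-- Expected complexity of the stochastic line search, in terms of what a true iteration
guarantees for the step and for the gradient estimate. -/
theorem IsLineSearchRun.lintegral_hittingTime_le {P : Measure Ω} [IsProbabilityMeasure P]
    {ℱ : Filtration ℕ mΩ} (run : IsLineSearchRun f c τ tmax t₀ x₀ X T S G)
    (hc : 0 < c ∧ c < 1) (hτ : 0 < τ ∧ τ < 1) (ht₀ : 0 < t₀ ∧ t₀ ≤ tmax)
    {κ₁ κ₂ β L δ ε fstar tbar : ℝ} (hκ₁ : 0 < κ₁) (hκ₂ : 0 < κ₂) (hβ : 0 < β) (hL0 : 0 ≤ L)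
    (hδ : 0 < δ ∧ δ < 1 / 2) (hε : 0 < ε) (hf : Differentiable ℝ f)
    (hL : ∀ x y, ‖gradient f x - gradient f y‖ ≤ L * ‖x - y‖) (hmin : ∀ x, fstar ≤ f x)
    (hS : ∀ k, Measurable[ℱ (k + 1)] (S k))
    (hSG : ∀ k, Measurable[ℱ (k + 1)] (X k) →
      Measurable[ℱ (k + 1)] fun ω => inner ℝ (S k ω) (G k ω))
    (hdesc : ∀ k ω, inner ℝ (S k ω) (G k ω) ≤ 0) {A : ℕ → Set Ω}
    (hA : ∀ k, ∀ᵐ ω ∂P, 1 - δ ≤ (P⟦A k | ℱ k⟧) ω)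
    (htrue : ∀ᵐ ω ∂P, ∀ k : ℕ, (k : ℕ∞) < hittingTime f X ε ω → ω ∈ A k →
      ‖S k ω‖ ^ 2 ≤ κ₁ * -inner ℝ (S k ω) (G k ω) ∧ κ₂ * ‖G k ω‖ ≤ ‖S k ω‖ ∧
      ‖gradient f (X k ω) - G k ω‖ ≤ β * T k ω * ‖G k ω‖)
    (hadm : IsAdmissible τ tmax t₀ (stepThreshold c κ₁ κ₂ β L) tbar) :
    ∫⁻ ω, (hittingTime f X ε ω : ℝ≥0∞) ∂P ≤
      ENNReal.ofReal (complexityBound (f x₀ - fstar) c τ tmax t₀ κ₁ κ₂ β δ ε tbar) := by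
  have hbar := hadm.1
  have hlt := hadm.2.1
  have hmax : 0 < tmax := ht₀.1.trans_le ht₀.2
  have hgradcont : Continuous (gradient f) :=
    (LipschitzWith.of_dist_le_mul (K := ⟨L, hL0⟩) fun x y => by
      rw [dist_eq_norm, dist_eq_norm]; exact hL x y).continuous
  have hX := fun k => (run.measurable_iterates hf.continuous hS hSG k).1
  set h : ℝ := c * κ₂ ^ 2 * tbar * ε ^ 2 / (κ₁ * (1 + β * tmax) ^ 2) with hh
  have hden : 0 < 1 + β * tmax := by positivity
  have hpos : 0 < h :=
    div_pos (mul_pos (mul_pos (mul_pos hc.1 (pow_pos hκ₂ 2)) hbar) (pow_pos hε 2))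
      (mul_pos hκ₁ (pow_pos hden 2))
  -- The weight two lets a decrease of `f` by `h` pay for one upward move of the level and still
  -- leave a net drop of one.
  set W : ℕ → Ω → ℝ := fun k ω =>
    (|stepLevel τ tbar (T k ω)| : ℤ) + 2 * ((f (X k ω) - fstar) / h) with hWdef
  have hlog : 0 ≤ Real.logb τ (tbar / t₀) :=
    Real.logb_nonneg_of_base_lt_one hτ.1 hτ.2 (div_pos hbar ht₀.1) ((div_le_one ht₀.1).2 hlt.le)
  have hgap : 0 ≤ (f x₀ - fstar) / h := div_nonneg (sub_nonneg.2 (hmin _)) hpos.le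
  have hW0 : ∀ ω, W 0 ω ≤ Real.logb τ (tbar / t₀) + 2 * ((f x₀ - fstar) / h) := by
    intro ω
    simp only [hWdef, run.T_zero, run.X_zero]
    rw [abs_of_nonneg ((stepLevel_nonneg_iff hτ hbar ht₀.1).2 hlt.le)]
    gcongr
    exact Int.floor_le _
  have hW : ∀ k ω, 0 ≤ W k ω := by
    intro k ω
    have h1 : 0 ≤ (f (X k ω) - fstar) / h := div_nonneg (sub_nonneg.2 (hmin _)) hpos.le
    have h2 : (0 : ℝ) ≤ (|stepLevel τ tbar (T k ω)| : ℤ) := by exact_mod_cast abs_nonneg _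
    simp only [hWdef]
    linarith
  have hstep : ∀ᵐ ω ∂P, ∀ k : ℕ, (k : ℕ∞) < hittingTime f X ε ω →
      W (k + 1) ω ≤ W k ω + 1 ∧ (ω ∈ A k → W (k + 1) ω ≤ W k ω - 1) := by
    filter_upwards [htrue] with ω hω k hk
    obtain ⟨hup, hsucc, hunsucc⟩ := run.abs_stepLevel_succ_le hτ ht₀ hbar hlt k ω
    have hmono := run.objective_succ_le hc.1 hτ ht₀ (hdesc k ω)
    have hmono' : (f (X (k + 1) ω) - fstar) / h ≤ (f (X k ω) - fstar) / h := by gcongr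
    have hup' : ((|stepLevel τ tbar (T (k + 1) ω)| : ℤ) : ℝ) ≤
        (|stepLevel τ tbar (T k ω)| : ℤ) + 1 := by exact_mod_cast hup
    refine ⟨by simp only [hWdef]; linarith, fun hωA => ?_⟩
    obtain ⟨hs, hg, hacc⟩ := hω k hk hωA
    obtain ⟨hT, hTmax⟩ := run.stepLength_mem hτ ht₀ k ω
    have hdown : |stepLevel τ tbar (T (k + 1) ω)| ≤ |stepLevel τ tbar (T k ω)| - 1 →
        W (k + 1) ω ≤ W k ω - 1 := by
      intro h1
      have h2 : ((|stepLevel τ tbar (T (k + 1) ω)| : ℤ) : ℝ) ≤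
        (|stepLevel τ tbar (T k ω)| : ℤ) - 1 := by exact_mod_cast h1
      simp only [hWdef]
      linarith
    by_cases hsuc : f (X k ω + T k ω • S k ω) ≤
        f (X k ω) + c * T k ω * inner ℝ (S k ω) (G k ω)
    · rcases lt_or_ge (stepLevel τ tbar (T k ω)) 0 with hv | hv
      · exact hdown (hsucc hsuc hv)
      · have h1 := decrease_of_accepted hc.1 hκ₁ hκ₂ hβ hT hε
          ((stepLevel_nonneg_iff hτ hbar hT).1 hv) hTmax hs hg hacc
          (lt_hittingTime_iff.1 hk k le_rfl).le hsuc
        rw [← hh, ← (run.successful k ω hsuc).1] at h1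
        have h2 : (f (X (k + 1) ω) - fstar) / h ≤ (f (X k ω) - fstar) / h - 1 := by
          rw [div_sub_one hpos.ne']
          exact div_le_div_of_nonneg_right (by linarith) hpos.le
        simp only [hWdef]
        linarith
    · rcases le_or_gt (stepLevel τ tbar (T k ω)) 0 with hv | hv
      -- Failure at a nonpositive level is impossible at a true iteration.
      · exact absurd (line_search_accepts hf hL0 hL hκ₁ hκ₂ hβ hT hs hg hacc
          (run.stepLength_le_threshold hτ ht₀ hadm hv)) hsuc
      · exact hdown (hunsucc hsuc hv)
  refine (lintegral_le_of_drift ℱ (measurableSet_lt_hittingTime hgradcont hX ε)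
    (by linarith : 1 / 2 < 1 - δ) hA hW0 hW hstep).trans (ENNReal.ofReal_le_ofReal ?_)
  have hδ' : 0 < 1 - 2 * δ := by linarith
  have hM : (f x₀ - fstar) * (1 + β * tmax) ^ 2 * κ₁ / (c * κ₂ ^ 2 * tbar) / ε ^ 2 =
      (f x₀ - fstar) / h := by
    have hne : 1 + β * tmax ≠ 0 := by positivity
    have := hc.1.ne'
    rw [hh]
    field_simp
  rw [complexityBound, hM, div_mul_eq_mul_div, show 2 * (1 - δ) - 1 = 1 - 2 * δ by ring,
    div_le_div_iff₀ hδ' (by positivity)]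
  -- The drift bound is already stronger than the claim: it remains only to enlarge the
  -- coefficients, using that the gap and the logarithm are nonnegative.
  have h1 : Real.logb τ (tbar / t₀) + 2 * ((f x₀ - fstar) / h) ≤
      2 * ((f x₀ - fstar) / h + Real.logb τ (tbar / t₀)) := by linarith
  have h2 : (Real.logb τ (tbar / t₀) + 2 * ((f x₀ - fstar) / h)) * (1 - 2 * δ) ≤
      2 * (1 - δ) * ((f x₀ - fstar) / h + Real.logb τ (tbar / t₀)) := by
    nlinarith [mul_nonneg hgap hδ.1.le, mul_nonneg hlog hδ.1.le]
  calc _ = (Real.logb τ (tbar / t₀) + 2 * ((f x₀ - fstar) / h)) * (1 - 2 * δ) * (1 - 2 * δ) := by ring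
    _ ≤ _ := mul_le_mul_of_nonneg_right h2 hδ'.le

end LineSearch

/-! ### Properties of the two variants needed by the general bound. -/

theorem kappa₁_pos {ρ σmin μ : ℝ} (hρ : 0 < ρ) (hσ : 0 < σmin) (hμ : 0 < μ) :
    0 < kappa₁ ρ σmin μ := by
  unfold kappa₁; positivity

theorem kappa₂_pos {ρ σmax ηbar : ℝ} (hρ : 0 < ρ) (hσ : 0 < σmax) (hη : ηbar < 1) :
    0 < kappa₂ ρ σmax ηbar :=
  div_pos (by linarith) (by positivity)

theorem differentiable_objective {n : ℕ} {F : Type*} [NormedAddCommGroup F]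
    [InnerProductSpace ℝ F] [CompleteSpace F] (ρ : ℝ) {R : Euc n → F} (hR : ContDiff ℝ 1 R) :
    Differentiable ℝ (objective ρ R) := fun x =>
  (hasGradientAt_objective ρ (hR.differentiable one_ne_zero x)).differentiableAt

theorem IsInexactStep.inner_gradEstimate_nonpos {n : ℕ} {F : Type*} [NormedAddCommGroup F]
    [InnerProductSpace ℝ F] [CompleteSpace F] {ρ η : ℝ} (hρ : 0 < ρ) {A : Euc n →L[ℝ] F} {b : F}
    {K : Submodule ℝ (Euc n)} {s : Euc n} (h : IsInexactStep ρ A b η K s) :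
    inner ℝ s (gradEstimate ρ A b) ≤ 0 := by
  rw [h.inner_gradEstimate_eq hρ, neg_nonpos]
  positivity

/-- The compressed vectors live in a space that varies with `M`. A sum over all row indices with an
indicator removes this dependence, so that measurability in `ω` can be treated termwise. -/
theorem inner_compressedJac_compressedRes {n m : ℕ} (R : Euc n → Euc m) (x : Euc n)
    (M : Finset (Fin m)) (w : Fin m → ℝ) (s : Euc n) :
    inner ℝ (compressedJac R x M w s) (compressedRes R x M) =
      ∑ i, if i ∈ M then w i * (fderiv ℝ R x s) i * (R x) i else 0 := by
  rw [Finset.sum_ite_mem, Finset.univ_inter, ← Finset.sum_coe_sort M, PiLp.inner_apply]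
  refine Finset.sum_congr rfl fun i _ => ?_
  simp [compressedJac, compressedRes, selectRows, mul_comm]

section Measurability

variable {n m : ℕ} {Ω : Type*} {m₁ : MeasurableSpace Ω}

theorem measurable_inner_compressed {R : Euc n → Euc m} (hR : ContDiff ℝ 1 R) {X S : Ω → Euc n}
    {M : Ω → Finset (Fin m)} {w : Ω → Fin m → ℝ} (hX : Measurable X) (hS : Measurable S)
    (hM : ∀ A, MeasurableSet {ω | M ω = A}) (hw : Measurable w) :
    Measurable fun ω => inner ℝ (compressedJac R (X ω) (M ω) (w ω) (S ω))
      (compressedRes R (X ω) (M ω)) := by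
  simp_rw [inner_compressedJac_compressedRes]
  refine Finset.measurable_sum _ fun i _ => ?_
  have hset : MeasurableSet {ω | i ∈ M ω} := by
    have : {ω | i ∈ M ω} = ⋃ A ∈ {A : Finset (Fin m) | i ∈ A}, {ω | M ω = A} := by
      ext ω; simp
    rw [this]
    exact MeasurableSet.biUnion (Set.to_countable _) fun A _ => hM A
  have hcoord : Measurable fun v : Euc m => v i :=
    (EuclideanSpace.proj (𝕜 := ℝ) i).continuous.measurable
  have hJ : Measurable fun ω => fderiv ℝ R (X ω) (S ω) :=
    (hR.continuous_fderiv_apply one_ne_zero).measurable.comp (hX.prodMk hS)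
  exact Measurable.ite hset ((((measurable_pi_apply i).comp hw).mul (hcoord.comp hJ)).mul
    (hcoord.comp (hR.continuous.measurable.comp hX))) measurable_const

theorem measurable_inner_clm_apply {A : Ω → Euc n →L[ℝ] Euc m} {S : Ω → Euc n} {b : Ω → Euc m}
    (hA : Measurable A) (hS : Measurable S) (hb : Measurable b) :
    Measurable fun ω => inner ℝ (A ω (S ω)) (b ω) := by
  have hAS : Measurable fun ω => A ω (S ω) :=
    (isBoundedBilinearMap_apply (𝕜 := ℝ) (E := Euc n) (F := Euc m)).continuous.measurable.comp
      (hA.prodMk hS)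
  exact hAS.inner hb

end Measurability

/-! ### Complexity of row compression and of Jacobian sampling. -/

section Methods

variable {n m : ℕ} {Ω : Type*} [mΩ : MeasurableSpace Ω] {P : Measure Ω} [IsProbabilityMeasure P]
  {ℱ : Filtration ℕ mΩ} {c τ tmax t₀ ηbar σmin σmax μ α L δ ε : ℝ} {x₀ : Euc n}
  {X : ℕ → Ω → Euc n} {T : ℕ → Ω → ℝ} {S : ℕ → Ω → Euc n} {R : Euc n → Euc m} {fstar tbar : ℝ}

theorem IsRowCompressionRun.lintegral_hittingTime_le
    {M : ℕ → Ω → Finset (Fin m)} {w : ℕ → Ω → Fin m → ℝ}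
    (run : IsRowCompressionRun ℱ R c τ tmax t₀ ηbar x₀ X T S M w)
    (hc : 0 < c ∧ c < 1) (hτ : 0 < τ ∧ τ < 1) (ht₀ : 0 < t₀ ∧ t₀ ≤ tmax) (hη : ηbar < 1)
    (hσ : 0 < σmin ∧ σmin ≤ σmax) (hμ : 0 < μ) (hα : 0 < α)
    (hL0 : 0 ≤ L) (hδ : 0 < δ ∧ δ < 1 / 2) (hε : 0 < ε) (hm : 0 < m) (hR : ContDiff ℝ 1 R)
    (hmin : ∀ x, fstar ≤ objective (1 / m) R x)
    (hL : ∀ x y, ‖gradient (objective (1 / m) R) x - gradient (objective (1 / m) R) y‖ ≤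
      L * ‖x - y‖)
    (hprob : ∀ k, ∀ᵐ ω ∂P, 1 - δ ≤ (P⟦{ω | TrueRC R σmin σmax α X T M w k ω} | ℱ k⟧) ω)
    (hrow : ∀ᵐ ω ∂P, ∀ k : ℕ, (k : ℕ∞) < hittingTime (objective (1 / m) R) X ε ω →
      TrueRC R σmin σmax α X T M w k ω →
      μ * ‖S k ω‖ ≤ rowSpaceNorm (compressedJac R (X k ω) (M k ω) (w k ω)) (S k ω))
    (hadm : IsAdmissible τ tmax t₀
      (stepThreshold c (kappa₁ (1 / m) σmin μ) (kappa₂ (1 / m) σmax ηbar) α L) tbar) :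
    ∫⁻ ω, (hittingTime (objective (1 / m) R) X ε ω : ℝ≥0∞) ∂P ≤
      ENNReal.ofReal (complexityBound (objective (1 / m) R x₀ - fstar) c τ tmax t₀
        (kappa₁ (1 / m) σmin μ) (kappa₂ (1 / m) σmax ηbar) α δ ε tbar) := by
  have hρ : (0 : ℝ) < 1 / m := by positivity
  have hσmax : 0 < σmax := hσ.1.trans_le hσ.2
  refine run.lineSearch.lintegral_hittingTime_le hc hτ ht₀ (kappa₁_pos hρ hσ.1 hμ)
    (kappa₂_pos hρ hσmax hη) hα hL0 hδ hε (differentiable_objective _ hR) hL hmin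
    run.measurable_S (fun k hX => ?_) (fun k ω => ?_) hprob ?_ hadm
  · simp_rw [inner_gradEstimate]
    exact (measurable_inner_compressed hR hX (run.measurable_S k) (run.measurable_M k)
      (run.measurable_w k)).const_mul _
  · obtain ⟨η, -, -, ℓ, hstep⟩ := run.step k ω
    exact hstep.inner_gradEstimate_nonpos hρ
  · filter_upwards [hrow] with ω hω k hk htrue
    obtain ⟨η, -, hηlt, ℓ, hstep⟩ := run.step k ω
    exact ⟨hstep.norm_sq_le hρ hσ.1 hμ htrue.1 (hω k hk htrue),
      hstep.kappa₂_mul_norm_le hρ hσmax hηlt htrue.1, htrue.2⟩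

theorem IsJacobianSamplingRun.lintegral_hittingTime_le {ρ κ₃ : ℝ}
    {Jt : ℕ → Ω → Euc n →L[ℝ] Euc m}
    (run : IsJacobianSamplingRun ℱ ρ R c τ tmax t₀ ηbar x₀ X T S Jt) (hρ : 0 < ρ)
    (hc : 0 < c ∧ c < 1) (hτ : 0 < τ ∧ τ < 1) (ht₀ : 0 < t₀ ∧ t₀ ≤ tmax) (hη : ηbar < 1)
    (hσ : 0 < σmin ∧ σmin ≤ σmax) (hμ : 0 < μ) (hα : 0 < α)
    (hL0 : 0 ≤ L) (hδ : 0 < δ ∧ δ < 1 / 2) (hε : 0 < ε) (hR : ContDiff ℝ 1 R)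
    (hmin : ∀ x, fstar ≤ objective ρ R x)
    (hL : ∀ x y, ‖gradient (objective ρ R) x - gradient (objective ρ R) y‖ ≤ L * ‖x - y‖)
    (hprob : ∀ k, ∀ᵐ ω ∂P, 1 - δ ≤ (P⟦{ω | TrueJS R σmin σmax α X T Jt k ω} | ℱ k⟧) ω)
    (hκ₃ : 0 < κ₃)
    (hrow : ∀ᵐ ω ∂P, ∀ k : ℕ, (k : ℕ∞) < hittingTime (objective ρ R) X ε ω →
      TrueJS R σmin σmax α X T Jt k ω →
      μ * ‖S k ω‖ ≤ rowSpaceNorm (Jt k ω) (S k ω) ∧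
      1 / κ₃ * ‖R (X k ω)‖ ≤ ‖(ContinuousLinearMap.adjoint (Jt k ω)) (R (X k ω))‖)
    (hadm : IsAdmissible τ tmax t₀
      (stepThreshold c (kappa₁ ρ σmin μ) (kappa₂ ρ σmax ηbar) (α * κ₃) L) tbar) :
    ∫⁻ ω, (hittingTime (objective ρ R) X ε ω : ℝ≥0∞) ∂P ≤
      ENNReal.ofReal (complexityBound (objective ρ R x₀ - fstar) c τ tmax t₀
        (kappa₁ ρ σmin μ) (kappa₂ ρ σmax ηbar) (α * κ₃) δ ε tbar) := by
  have hσmax : 0 < σmax := hσ.1.trans_le hσ.2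
  refine run.lineSearch.lintegral_hittingTime_le hc hτ ht₀ (kappa₁_pos hρ hσ.1 hμ)
    (kappa₂_pos hρ hσmax hη) (mul_pos hα hκ₃) hL0 hδ hε (differentiable_objective _ hR) hL hmin
    run.measurable_S (fun k hX => ?_) (fun k ω => ?_) hprob ?_ hadm
  · simp_rw [inner_gradEstimate]
    exact (measurable_inner_clm_apply (run.measurable_Jt k) (run.measurable_S k)
      (hR.continuous.measurable.comp hX)).const_mul _
  · obtain ⟨η, -, -, K, hstep⟩ := run.step k ω
    exact hstep.inner_gradEstimate_nonpos hρ
  · filter_upwards [hrow] with ω hω k hk htrue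
    obtain ⟨η, -, hηlt, K, hstep⟩ := run.step k ω
    obtain ⟨hV, hκ⟩ := hω k hk htrue
    refine ⟨hstep.norm_sq_le hρ hσ.1 hμ htrue.1 hV,
      hstep.kappa₂_mul_norm_le hρ hσmax hηlt htrue.1, ?_⟩
    rw [mul_right_comm α κ₃]
    exact norm_gradient_objective_sub_gradEstimate_le hρ hκ₃
      (hR.differentiable one_ne_zero _) htrue.2 hκ

end Methods

end StochasticGaussNewton

/-! ### The three problem and method combinations. -/

theorem theorem3p15
    {Ω : Type*} [mΩ : MeasurableSpace Ω] (P : Measure Ω) [IsProbabilityMeasure P]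
    (ℱ : Filtration ℕ mΩ) {n : ℕ}
    -- parameters of the algorithm
    (c τ tmax t₀ ηbar : ℝ) (hc : 0 < c ∧ c < 1) (hτ : 0 < τ ∧ τ < 1)
    (ht₀ : 0 < t₀ ∧ t₀ ≤ tmax) (hη : 0 < ηbar ∧ ηbar < 1)
    -- constants in the assumptions
    (σmin σmax μ α L δ ε : ℝ) (hσ : 0 < σmin ∧ σmin ≤ σmax) (hμ : 0 < μ) (hα : 0 < α)
    (hL : 0 ≤ L) (hδ : 0 < δ ∧ δ < 1 / 2) (hε : 0 < ε)
    -- initial point, iterates, step-lengths, search directions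
    (x₀ : Euc n) (X : ℕ → Ω → Euc n)
    (T : ℕ → Ω → ℝ) (S : ℕ → Ω → Euc n) :
    -- nonlinear least squares, row compression of the Jacobian
    (∀ (m : ℕ) (R : Euc n → Euc m)
        (M : ℕ → Ω → Finset (Fin m)) (w : ℕ → Ω → Fin m → ℝ)
        (xstar : Euc n) (tbar : ℝ),
      0 < m → ContDiff ℝ 1 R →
      (∀ x, objective (1 / m) R xstar ≤
        objective (1 / m) R x) →
      (∀ x y, ‖gradient (objective (1 / m) R) x -
        gradient (objective (1 / m) R) y‖ ≤ L * ‖x - y‖) →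
      IsRowCompressionRun ℱ R c τ tmax t₀ ηbar x₀ X T S M w →
      (∀ k, ∀ᵐ ω ∂P,
        1 - δ ≤ (P⟦{ω | TrueRC R σmin σmax α X T M w k ω} | ℱ k⟧) ω) →
      (∀ᵐ ω ∂P, ∀ k : ℕ,
        (k : ℕ∞) <
          hittingTime (objective (1 / m) R) X ε ω →
        TrueRC R σmin σmax α X T M w k ω →
        μ * ‖S k ω‖ ≤ rowSpaceNorm
          (compressedJac R (X k ω) (M k ω) (w k ω)) (S k ω)) →
      IsAdmissible τ tmax t₀
        (stepThreshold c (kappa₁ (1 / m) σmin μ)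
          (kappa₂ (1 / m) σmax ηbar) α L) tbar →
      ∫⁻ ω, (hittingTime
          (objective (1 / m) R) X ε ω : ℝ≥0∞) ∂P ≤
        ENNReal.ofReal (complexityBound
          (objective (1 / m) R x₀ -
            objective (1 / m) R xstar) c τ tmax t₀
          (kappa₁ (1 / m) σmin μ)
          (kappa₂ (1 / m) σmax ηbar) α δ ε tbar)) ∧
    -- nonlinear least squares, Jacobian sampling
    (∀ (m : ℕ) (R : Euc n → Euc m)
        (Jt : ℕ → Ω → Euc n →L[ℝ] Euc m)
        (xstar : Euc n) (κ₃ tbar : ℝ),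
      0 < m → ContDiff ℝ 1 R →
      (∀ x, objective (1 / m) R xstar ≤
        objective (1 / m) R x) →
      (∀ x y, ‖gradient (objective (1 / m) R) x -
        gradient (objective (1 / m) R) y‖ ≤ L * ‖x - y‖) →
      IsJacobianSamplingRun ℱ (1 / m) R c τ tmax t₀ ηbar x₀ X T S Jt →
      (∀ k, ∀ᵐ ω ∂P,
        1 - δ ≤ (P⟦{ω | TrueJS R σmin σmax α X T Jt k ω} | ℱ k⟧) ω) →
      0 < κ₃ →
      (∀ᵐ ω ∂P, ∀ k : ℕ,
        (k : ℕ∞) <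
          hittingTime (objective (1 / m) R) X ε ω →
        TrueJS R σmin σmax α X T Jt k ω →
        μ * ‖S k ω‖ ≤ rowSpaceNorm (Jt k ω) (S k ω) ∧
        1 / κ₃ * ‖R (X k ω)‖ ≤ ‖(ContinuousLinearMap.adjoint (Jt k ω)) (R (X k ω))‖) →
      IsAdmissible τ tmax t₀
        (stepThreshold c (kappa₁ (1 / m) σmin μ)
          (kappa₂ (1 / m) σmax ηbar) (α * κ₃) L) tbar →
      ∫⁻ ω, (hittingTime
          (objective (1 / m) R) X ε ω : ℝ≥0∞) ∂P ≤
        ENNReal.ofReal (complexityBound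
          (objective (1 / m) R x₀ -
            objective (1 / m) R xstar) c τ tmax t₀
          (kappa₁ (1 / m) σmin μ)
          (kappa₂ (1 / m) σmax ηbar) (α * κ₃) δ ε tbar)) ∧
    -- nonlinear systems of equations, Jacobian sampling
    (∀ (F : Euc n → Euc n)
        (Jt : ℕ → Ω → Euc n →L[ℝ] Euc n)
        (xstar : Euc n) (κ₃ tbar : ℝ),
      ContDiff ℝ 1 F →
      F xstar = 0 →
      (∀ x y, ‖gradient (objective 1 F) x -
        gradient (objective 1 F) y‖ ≤ L * ‖x - y‖) →
      IsJacobianSamplingRun ℱ 1 F c τ tmax t₀ ηbar x₀ X T S Jt →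
      (∀ k, ∀ᵐ ω ∂P,
        1 - δ ≤ (P⟦{ω | TrueJS F σmin σmax α X T Jt k ω} | ℱ k⟧) ω) →
      0 < κ₃ →
      (∀ᵐ ω ∂P, ∀ k : ℕ,
        (k : ℕ∞) <
          hittingTime (objective 1 F) X ε ω →
        TrueJS F σmin σmax α X T Jt k ω →
        μ * ‖S k ω‖ ≤ rowSpaceNorm (Jt k ω) (S k ω) ∧
        1 / κ₃ * ‖F (X k ω)‖ ≤ ‖(ContinuousLinearMap.adjoint (Jt k ω)) (F (X k ω))‖) →
      IsAdmissible τ tmax t₀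
        (stepThreshold c (kappa₁ 1 σmin μ)
          (kappa₂ 1 σmax ηbar) (α * κ₃) L) tbar →
      ∫⁻ ω, (hittingTime
          (objective 1 F) X ε ω : ℝ≥0∞) ∂P ≤
        ENNReal.ofReal (complexityBound
          (objective 1 F x₀) c τ tmax t₀
          (kappa₁ 1 σmin μ)
          (kappa₂ 1 σmax ηbar) (α * κ₃) δ ε tbar)) := by
  refine ⟨?_, ?_, ?_⟩
  · intro m R M w xstar tbar hm hR hmin hLip run hprob hrow hadm
    exact run.lintegral_hittingTime_le hc hτ ht₀ hη.2 hσ hμ hα hL hδ hε hm hR hmin hLip hprob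
      hrow hadm
  · intro m R Jt xstar κ₃ tbar hm hR hmin hLip run hprob hκ₃ hrow hadm
    exact run.lintegral_hittingTime_le (by positivity) hc hτ ht₀ hη.2 hσ hμ hα hL hδ hε hR hmin
      hLip hprob hκ₃ hrow hadm
  · intro F Jt xstar κ₃ tbar hF hzero hLip run hprob hκ₃ hrow hadm
    -- For nonlinear systems the lower bound `f* = 0` is used, so the gap is `objective 1 F x₀`
    -- itself.
    have hmin : ∀ x, (0 : ℝ) ≤ objective 1 F x := fun x => by unfold objective; positivity
    simpa only [sub_zero] using run.lintegral_hittingTime_le one_pos hc hτ ht₀ hη.2 hσ hμ hα hL hδ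
      hε hF hmin hLip hprob hκ₃ hrow hadm
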